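/- There is a universal constant $c_1>0$ such that the following holds. Let $n_L,n_R,K_L,K_R\ge 1$ and $r\ge 0$ be integers with $n_L\ge rK_L$, $n_R\ge rK_R$, put $n=\max\{n_L,n_R\}$, and let $\mu>0$. Let $C_1^*,\dots,C_r^*\subseteq\{1,\dots,n_L\}$ be pairwise disjoint sets of size $K_L$, let $D_1^*,\dots,D_r^*\subseteq\{1,\dots,n_R\}$ be pairwise disjoint sets of size $K_R$, and let $Y^*\in\{0,1\}^{n_L\times n_R}$ be the matrix with $Y^*_{ij}=1$ if and only if $(i,j)\in C_m^*\times D_m^*$ for some $m$. Let $A$ be the random $n_L\times n_R$ matrix $A_{ij}=\mu Y^*_{ij}+\Delta_{ij}$, where the $\Delta_{ij}$ are i.i.d. zero-mean random variables that are sub-Gaussian with parameter $1$, i.e. $\mathbb E[e^{t\Delta_{ij}}]\le e^{t^2/2}$ for all $t\in\mathbb R$. If $$\mu^2\ \ge\ c_1\left(\frac{\log n}{\min\{K_L,K_R\}}+\frac{n}{K_LK_R}\right),$$ then with probability at least $1-n^{-10}$ the optimal solution of the convex program $$\max_{Y\in\mathbb R^{n_L\times n_R}}\ \sum_{i,j}A_{ij}Y_{ij}\quad\text{subject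 to}\quad \|Y\|_*\le r\sqrt{K_LK_R},\quad \sum_{i,j}Y_{ij}=rK_LK_R,\quad 0\le Y_{ij}\le 1\ \text{ for all } i,j$$ is unique and equals $Y^*$, where $\|Y\|_*$ denotes the sum of the singular values of $Y$. -/

import Mathlib

open MeasureTheory ProbabilityTheory

namespace SubmatrixLocalization

/-- The trace norm (nuclear norm) of a real matrix: the sum of its singular values. -/
noncomputable def traceNorm {m n : ℕ} (Y : Matrix (Fin m) (Fin n) ℝ) : ℝ :=
  (Matrix.toEuclideanLin Y).singularValues.sum fun _ s => s

/-- `C 0, …, C (r - 1)` are pairwise disjoint subsets of `{0, …, n - 1}`, each of size `K`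
(in particular `r * K ≤ n`). Indices that belong to no `C m` are the isolated nodes. -/
structure IsClusterFamily {n r : ℕ} (K : ℕ) (C : Fin r → Finset (Fin n)) : Prop where
  disjoint : ∀ m m' : Fin r, m ≠ m' → Disjoint (C m) (C m')
  card_eq : ∀ m : Fin r, (C m).card = K

/-- The bi-clustering matrix `Y*`: its entry `(i, j)` is `1` if `(i, j) ∈ C m × D m` for some `m`,
and `0` otherwise. -/
def biclusteringMatrix {nL nR r : ℕ} (C : Fin r → Finset (Fin nL)) (D : Fin r → Finset (Fin nR)) :
    Matrix (Fin nL) (Fin nR) ℝ :=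
  Matrix.of fun i j => if ∃ m : Fin r, i ∈ C m ∧ j ∈ D m then 1 else 0

/-- The noise entries `Δ i j` are i.i.d. zero-mean random variables which are sub-Gaussian with
parameter `1`, that is, `E[exp (t * Δ i j)] ≤ exp (t ^ 2 / 2)` for all real `t`. -/
structure IsSubGaussianNoise {Ω : Type*} [MeasurableSpace Ω] {nL nR : ℕ}
    (Δ : Fin nL → Fin nR → Ω → ℝ) (P : Measure Ω) : Prop where
  measurable : ∀ i j, Measurable (Δ i j)
  indep : iIndepFun (fun p : Fin nL × Fin nR => Δ p.1 p.2) P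
  identDistrib : ∀ p q : Fin nL × Fin nR, IdentDistrib (Δ p.1 p.2) (Δ q.1 q.2) P P
  integrable : ∀ i j, Integrable (Δ i j) P
  mean_zero : ∀ i j, ∫ ω, Δ i j ω ∂P = 0
  subGaussian : ∀ i j, HasSubgaussianMGF (Δ i j) 1 P

/-- The random matrix `A`: its entry `(i, j)` is `μ + Δ i j` if `(i, j) ∈ C m × D m` for some `m`,
and `Δ i j` otherwise. -/
def observedMatrix {Ω : Type*} {nL nR r : ℕ} (μ : ℝ)
    (C : Fin r → Finset (Fin nL)) (D : Fin r → Finset (Fin nR))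
    (Δ : Fin nL → Fin nR → Ω → ℝ) (ω : Ω) : Matrix (Fin nL) (Fin nR) ℝ :=
  Matrix.of fun i j => if ∃ m : Fin r, i ∈ C m ∧ j ∈ D m then μ + Δ i j ω else Δ i j ω

/-- The objective `∑ i j, A i j * Y i j` of the convex program. -/
def objective {nL nR : ℕ} (A Y : Matrix (Fin nL) (Fin nR) ℝ) : ℝ :=
  ∑ i, ∑ j, A i j * Y i j

/-- The feasible set of the convex program. -/
def feasibleSet (nL nR KL KR r : ℕ) : Set (Matrix (Fin nL) (Fin nR) ℝ) :=
  {Y | traceNorm Y ≤ (r : ℝ) * √((KL : ℝ) * (KR : ℝ)) ∧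
    ∑ i, ∑ j, Y i j = (r : ℝ) * (KL : ℝ) * (KR : ℝ) ∧
    ∀ i j, 0 ≤ Y i j ∧ Y i j ≤ 1}

/-- `x` is an optimal solution of the problem of maximizing `f` over `S`, and the only one. -/
def IsUniqueMaximizer {α : Type*} (f : α → ℝ) (S : Set α) (x : α) : Prop :=
  (x ∈ S ∧ IsMaxOn f S x) ∧ ∀ y, y ∈ S ∧ IsMaxOn f S y → y = x

end SubmatrixLocalization

/-!
The planted matrix `Y*` is compared with a feasible `Y` by means of a dual certificate. Put
`κ = √(KL * KR)`, and let `PL`, `PR` be the orthogonal projections onto the spans of the row and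
column cluster indicators. Then `Y* / κ` is a partial isometry from the range of `PR` onto the range
of `PL`, so for every contraction `G` the matrix `Y* / κ + (1 - PL) G (1 - PR)` is again a
contraction, and pairs with any `Y` to at most its trace norm. It pairs with `Y*` to `r κ`, the
largest trace norm allowed. With `G = Δ / l`, where `l` bounds the operator norm of the noise `Δ`,
this bounds the pairing of `(1 - PL) Δ (1 - PR)` with `Y* - Y` from below by `-(l / κ) s`, where
`s = ⟨Y*, Y* - Y⟩`. The rest of the noise, `PL Δ + Δ PR - PL Δ PR`, consists of averages over
clusters, so it has small entries, at most `3 τ` say; and `∑ |Y* - Y| = 2 s` because all feasible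
matrices have the same sum. Hence the objective at `Y*` exceeds the one at `Y` by at least
`(μ - l / κ - 6 τ) s`, which is `IsClusterFamily.isUniqueMaximizer_of_noise_bounds`.

It remains to see that `l = μ κ / 4` and `τ = μ / 16` work with high probability. The entries of
`PL Δ` and `Δ PR` are sub-Gaussian with variance proxy at most `1 / min KL KR`, and a union bound
over them costs `log n`. The operator norm is at most `4` times the maximum of the bilinear form
`⟨x, Δ y⟩` over two `1 / 2`-nets of the unit balls, with at most `5 ^ nL` and `5 ^ nR` points; this
gives the order `√n` without a logarithm (`IsSubGaussianNoise.measureReal_noise_bounds_compl_le`).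
-/

namespace SubmatrixLocalization

/-! ### Half nets and the operator norm -/

/-- The unit ball of a `d`-dimensional normed space has a `1 / 2`-net of at most `5 ^ d` points:
take a `1`-separated subset of the ball of radius `2` of maximal size, and halve it. -/
theorem exists_half_net (E : Type*) [NormedAddCommGroup E] [NormedSpace ℝ E]
    [FiniteDimensional ℝ E] :
    ∃ N : Finset E, N.card ≤ 5 ^ Module.finrank ℝ E ∧ (∀ z ∈ N, ‖z‖ ≤ 1) ∧
      ∀ x : E, ‖x‖ ≤ 1 → ∃ z ∈ N, ‖x - z‖ ≤ 1 / 2 := by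
  classical
  let p : ℕ → Prop := fun k => ∃ s : Finset E, s.card = k ∧ (∀ c ∈ s, ‖c‖ ≤ 2) ∧
    ∀ c ∈ s, ∀ d ∈ s, c ≠ d → 1 ≤ ‖c - d‖
  have hp0 : p 0 := ⟨∅, by simp⟩
  obtain ⟨s, hcard, hs, hsep⟩ :=
    Nat.findGreatest_spec (P := p) (Nat.zero_le (5 ^ Module.finrank ℝ E)) hp0
  have hle := Besicovitch.card_le_of_separated s hs hsep
  refine ⟨s.image fun z => (1 / 2 : ℝ) • z, Finset.card_image_le.trans hle, ?_, ?_⟩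
  · intro z hz
    obtain ⟨c, hc, rfl⟩ := Finset.mem_image.1 hz
    rw [norm_smul, Real.norm_of_nonneg (by norm_num)]
    linarith [hs c hc]
  · intro x hx
    by_contra! hcon
    have hfar : ∀ c ∈ s, 1 ≤ ‖(2 : ℝ) • x - c‖ := by
      intro c hc
      have h1 := hcon _ (Finset.mem_image_of_mem _ hc)
      have h2 : x - (1 / 2 : ℝ) • c = (1 / 2 : ℝ) • ((2 : ℝ) • x - c) := by
        rw [smul_sub, smul_smul]; norm_num
      rw [h2, norm_smul, Real.norm_of_nonneg (by norm_num)] at h1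
      linarith
    have hx2 : ‖(2 : ℝ) • x‖ ≤ 2 := by
      rw [norm_smul, Real.norm_of_nonneg (by norm_num)]; linarith
    have hnot : (2 : ℝ) • x ∉ s := fun hmem => by
      have := hfar _ hmem
      simp at this
      linarith
    -- adjoining `2 • x` would give a larger separated set
    have hs' : ∀ c ∈ insert ((2 : ℝ) • x) s, ‖c‖ ≤ 2 := by
      intro c hc
      rcases Finset.mem_insert.1 hc with rfl | hc
      exacts [hx2, hs c hc]
    have hsep' : ∀ c ∈ insert ((2 : ℝ) • x) s, ∀ d ∈ insert ((2 : ℝ) • x) s,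
        c ≠ d → 1 ≤ ‖c - d‖ := by
      intro c hc d hd hcd
      rcases Finset.mem_insert.1 hc with rfl | hc <;> rcases Finset.mem_insert.1 hd with rfl | hd
      · exact absurd rfl hcd
      · exact hfar d hd
      · rw [norm_sub_rev]; exact hfar c hc
      · exact hsep c hc d hd hcd
    have hbig := Nat.le_findGreatest (P := p)
      (Besicovitch.card_le_of_separated _ hs' hsep') ⟨_, rfl, hs', hsep'⟩
    rw [Finset.card_insert_of_notMem hnot, hcard] at hbig
    omega

/-- Approximating a unit vector `x` by a point of the net gives `‖L‖ ≤ c + ‖L‖ / 2`. -/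
theorem opNorm_le_of_half_net {E F : Type*} [NormedAddCommGroup E] [NormedSpace ℝ E]
    [NormedAddCommGroup F] [NormedSpace ℝ F] (L : E →L[ℝ] F) {N : Finset E}
    (hN : ∀ x : E, ‖x‖ ≤ 1 → ∃ z ∈ N, ‖x - z‖ ≤ 1 / 2) {c : ℝ} (hc : 0 ≤ c)
    (h : ∀ z ∈ N, ‖L z‖ ≤ c) : ‖L‖ ≤ 2 * c := by
  suffices h1 : ‖L‖ ≤ c + ‖L‖ / 2 by linarith
  refine L.opNorm_le_of_unit_norm (by positivity) fun x hx => ?_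
  obtain ⟨z, hz, hxz⟩ := hN x hx.le
  calc ‖L x‖ = ‖L z + L (x - z)‖ := by rw [← map_add]; congr 2; abel
    _ ≤ ‖L z‖ + ‖L (x - z)‖ := norm_add_le _ _
    _ ≤ c + ‖L‖ * ‖x - z‖ := add_le_add (h z hz) (L.le_opNorm _)
    _ ≤ c + ‖L‖ * (1 / 2) := by gcongr
    _ = c + ‖L‖ / 2 := by ring

theorem euclidean_inner_eq_dotProduct {k : ℕ} (u v : EuclideanSpace ℝ (Fin k)) :
    inner ℝ u v = u.ofLp ⬝ᵥ v.ofLp := by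
  rw [EuclideanSpace.inner_eq_star_dotProduct, dotProduct_comm]
  simp

theorem ofLp_toEuclideanLin_eq_mulVec {m n : ℕ} (M : Matrix (Fin m) (Fin n) ℝ)
    (v : EuclideanSpace ℝ (Fin n)) : (M.toEuclideanLin v).ofLp = M.mulVec v.ofLp := rfl

/-- Bounds `t` on the bilinear form of `M` over two half nets give `‖M‖ ≤ 4 * t`: each of the two
nets costs a factor `2`. -/
theorem mulVec_dotProduct_le_of_nets {m n : ℕ} (M : Matrix (Fin m) (Fin n) ℝ)
    {NL : Finset (EuclideanSpace ℝ (Fin m))} {NR : Finset (EuclideanSpace ℝ (Fin n))}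
    (hNL : ∀ x, ‖x‖ ≤ 1 → ∃ z ∈ NL, ‖x - z‖ ≤ 1 / 2)
    (hNR : ∀ x, ‖x‖ ≤ 1 → ∃ z ∈ NR, ‖x - z‖ ≤ 1 / 2) {t : ℝ} (ht : 0 ≤ t)
    (h : ∀ x ∈ NL, ∀ y ∈ NR, |x.ofLp ⬝ᵥ M.mulVec y.ofLp| ≤ t) (y : Fin n → ℝ) :
    M.mulVec y ⬝ᵥ M.mulVec y ≤ (4 * t) ^ 2 * (y ⬝ᵥ y) := by
  set T := M.toEuclideanLin.toContinuousLinearMap with hT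
  have hTv : ∀ v, (T v).ofLp = M.mulVec v.ofLp := fun v => rfl
  have hTn : ‖T‖ ≤ 2 * (2 * t) := by
    refine opNorm_le_of_half_net T hNR (by positivity) fun z hz => ?_
    rw [← innerSL_apply_norm ℝ (T z)]
    refine opNorm_le_of_half_net _ hNL ht fun x hx => ?_
    rw [innerSL_apply_apply, real_inner_comm, euclidean_inner_eq_dotProduct, hTv, Real.norm_eq_abs]
    exact h x hx z hz
  have hb := T.le_of_opNorm_le hTn (WithLp.toLp 2 y)
  have hsq : ‖T (WithLp.toLp 2 y)‖ ^ 2 ≤ (2 * (2 * t) * ‖WithLp.toLp 2 y‖) ^ 2 := by gcongr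
  rw [mul_pow, ← real_inner_self_eq_norm_sq, ← real_inner_self_eq_norm_sq,
    euclidean_inner_eq_dotProduct, euclidean_inner_eq_dotProduct, hTv] at hsq
  calc _ ≤ _ := hsq
    _ = _ := by ring

/-! ### The trace norm -/

/-- In an orthonormal eigenbasis `b` of `Yᵀ * Y`, the singular values of `Y` are the `‖Y (b k)‖`. -/
theorem exists_basis_traceNorm_eq {m n : ℕ} (Y : Matrix (Fin m) (Fin n) ℝ) :
    ∃ b : OrthonormalBasis (Fin n) ℝ (EuclideanSpace ℝ (Fin n)),
      traceNorm Y = ∑ k, ‖Y.toEuclideanLin (b k)‖ ∧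
      ∀ k, (Y.transpose * Y).mulVec (b k).ofLp =
        (‖Y.toEuclideanLin (b k)‖ ^ 2) • (b k).ofLp := by
  set T := Y.toEuclideanLin with hT
  have hn : Module.finrank ℝ (EuclideanSpace ℝ (Fin n)) = n := by simp
  have hS := T.isSymmetric_adjoint_comp_self
  set b := hS.eigenvectorBasis hn with hb
  have happ : ∀ k, (T.adjoint ∘ₗ T) (b k) = hS.eigenvalues hn k • b k := fun k => by
    exact hS.apply_eigenvectorBasis hn k
  have hev : ∀ k, hS.eigenvalues hn k = ‖T (b k)‖ ^ 2 := by
    intro k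
    have h1 : inner ℝ (b k) ((T.adjoint ∘ₗ T) (b k)) = ‖T (b k)‖ ^ 2 := by
      rw [LinearMap.comp_apply, LinearMap.adjoint_inner_right, real_inner_self_eq_norm_sq]
    rw [← h1, happ, inner_smul_right, real_inner_self_eq_norm_sq, b.norm_eq_one]
    simp
  refine ⟨b, ?_, fun k => ?_⟩
  · have hsub : T.singularValues.support ⊆ Finset.range n := by
      intro i hi
      rw [Finset.mem_range]
      by_contra hni
      exact (Finsupp.mem_support_iff.1 hi)
        (T.singularValues_of_finrank_le (by rw [hn]; omega))
    rw [traceNorm, Finsupp.sum_of_support_subset _ hsub _ (by simp), Finset.sum_range]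
    refine Finset.sum_congr rfl fun k _ => ?_
    rw [T.singularValues_fin hn, hev, Real.sqrt_sq (norm_nonneg _)]
  · have h2 := happ k
    rw [hev, LinearMap.comp_apply, hT, ← Matrix.toEuclideanLin_conjTranspose_eq_adjoint] at h2
    have h3 := congrArg WithLp.ofLp h2
    simpa [ofLp_toEuclideanLin_eq_mulVec, Matrix.mulVec_mulVec] using h3

theorem sum_mul_eq_sum_inner {m n : ℕ} (M Y : Matrix (Fin m) (Fin n) ℝ)
    (b : OrthonormalBasis (Fin n) ℝ (EuclideanSpace ℝ (Fin n))) :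
    ∑ i, ∑ j, M i j * Y i j = ∑ k, inner ℝ (M.toEuclideanLin (b k)) (Y.toEuclideanLin (b k)) := by
  have h : ∀ k, inner ℝ (M.toEuclideanLin (b k)) (Y.toEuclideanLin (b k)) =
      ∑ i, inner ℝ (WithLp.toLp 2 (M i)) (b k) * inner ℝ (b k) (WithLp.toLp 2 (Y i)) := by
    intro k
    rw [euclidean_inner_eq_dotProduct, dotProduct]
    refine Finset.sum_congr rfl fun i _ => ?_
    rw [euclidean_inner_eq_dotProduct, euclidean_inner_eq_dotProduct,
      dotProduct_comm (b k).ofLp, ofLp_toEuclideanLin_eq_mulVec,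
      ofLp_toEuclideanLin_eq_mulVec]
    rfl
  simp_rw [h]
  conv_rhs => rw [Finset.sum_comm]
  refine Finset.sum_congr rfl fun i _ => ?_
  rw [b.sum_inner_mul_inner, euclidean_inner_eq_dotProduct]
  rfl

/-- `M` has Euclidean operator norm at most `1`, stated with squared norms. -/
def IsContraction {m n : ℕ} (M : Matrix (Fin m) (Fin n) ℝ) : Prop :=
  ∀ y, M.mulVec y ⬝ᵥ M.mulVec y ≤ y ⬝ᵥ y

/-- The trace norm dominates the pairing with every contraction. -/
theorem IsContraction.sum_mul_le_traceNorm {m n : ℕ} {M : Matrix (Fin m) (Fin n) ℝ}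
    (hM : IsContraction M) (Y : Matrix (Fin m) (Fin n) ℝ) :
    ∑ i, ∑ j, M i j * Y i j ≤ traceNorm Y := by
  obtain ⟨b, hb, -⟩ := exists_basis_traceNorm_eq Y
  rw [sum_mul_eq_sum_inner M Y b, hb]
  refine Finset.sum_le_sum fun k _ => (real_inner_le_norm _ _).trans ?_
  have h1 : ‖M.toEuclideanLin (b k)‖ ≤ 1 := by
    have h2 := hM (b k).ofLp
    rw [← ofLp_toEuclideanLin_eq_mulVec, ← euclidean_inner_eq_dotProduct,
      ← euclidean_inner_eq_dotProduct, real_inner_self_eq_norm_sq, real_inner_self_eq_norm_sq,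
      b.norm_eq_one] at h2
    exact (sq_le_sq₀ (norm_nonneg _) zero_le_one).1 h2
  exact mul_le_of_le_one_left (norm_nonneg _) h1

/-- If every nonzero singular value of `Y` equals `s`, which the hypothesis `hY` says, then the
trace norm times `s` is the squared Frobenius norm. -/
theorem mul_traceNorm_eq_sum_sq {m n : ℕ} {Y : Matrix (Fin m) (Fin n) ℝ} {s : ℝ} (hs : 0 ≤ s)
    (hY : Y.transpose * Y * (Y.transpose * Y) = (s ^ 2) • (Y.transpose * Y)) :
    s * traceNorm Y = ∑ i, ∑ j, Y i j * Y i j := by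
  obtain ⟨b, hb, hev⟩ := exists_basis_traceNorm_eq Y
  rw [sum_mul_eq_sum_inner Y Y b, hb, Finset.mul_sum]
  refine Finset.sum_congr rfl fun k _ => ?_
  rw [real_inner_self_eq_norm_sq]
  set σ := ‖Y.toEuclideanLin (b k)‖ with hσ
  have h1 := congrArg (fun A => A.mulVec (b k).ofLp ⬝ᵥ (b k).ofLp) hY
  have hbb : (b k).ofLp ⬝ᵥ (b k).ofLp = 1 := by
    rw [← euclidean_inner_eq_dotProduct, real_inner_self_eq_norm_sq, b.norm_eq_one, one_pow]
  simp only [← Matrix.mulVec_mulVec, Matrix.smul_mulVec] at h1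
  simp only [Matrix.mulVec_mulVec, hev, Matrix.mulVec_smul, smul_dotProduct, hbb,
    smul_eq_mul, mul_one] at h1
  have hσ0 : 0 ≤ σ := norm_nonneg _
  rcases hσ0.eq_or_lt with h0 | hpos
  · rw [← h0]; ring
  · have : σ ^ 2 = s ^ 2 := mul_right_cancel₀ (pow_ne_zero 2 hpos.ne') h1
    rw [(sq_eq_sq₀ hσ0 hs).1 this, sq]

/-! ### Contractions built from projections -/

theorem dotProduct_mulVec_eq_transpose {m n : ℕ} (A : Matrix (Fin m) (Fin n) ℝ)
    (v : Fin m → ℝ) (w : Fin n → ℝ) :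
    v ⬝ᵥ A.mulVec w = A.transpose.mulVec v ⬝ᵥ w := by
  rw [Matrix.dotProduct_mulVec, Matrix.mulVec_transpose]

/-- Pythagoras for an orthogonal projection `P`. -/
theorem dotProduct_self_eq_add_of_projection {n : ℕ} {P : Matrix (Fin n) (Fin n) ℝ}
    (hPt : P.transpose = P) (hP : P * P = P) (y : Fin n → ℝ) :
    y ⬝ᵥ y = P.mulVec y ⬝ᵥ P.mulVec y + (1 - P).mulVec y ⬝ᵥ (1 - P).mulVec y := by
  have h1 : P.mulVec y ⬝ᵥ P.mulVec y = y ⬝ᵥ P.mulVec y := by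
    rw [dotProduct_mulVec_eq_transpose, hPt, Matrix.mulVec_mulVec, hP, dotProduct_comm]
  rw [Matrix.sub_mulVec, Matrix.one_mulVec, sub_dotProduct, dotProduct_sub, dotProduct_sub,
    dotProduct_comm (P.mulVec y) y, h1]
  ring

/-- If `E` is a partial isometry with initial projection `Q` and range fixed by `P`, then adding to
it a contraction compressed to the complements of `P` and `Q` yields a contraction: the two
summands act on orthogonal subspaces and have orthogonal ranges. -/
theorem IsContraction.add_compl_mul_mul_compl {m n : ℕ} {P : Matrix (Fin m) (Fin m) ℝ}
    {Q : Matrix (Fin n) (Fin n) ℝ} {E G : Matrix (Fin m) (Fin n) ℝ}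
    (hPt : P.transpose = P) (hP : P * P = P) (hQt : Q.transpose = Q) (hQ : Q * Q = Q)
    (hPE : P * E = E) (hE : E.transpose * E = Q) (hG : IsContraction G) :
    IsContraction (E + (1 - P) * G * (1 - Q)) := by
  intro y
  set w := G.mulVec ((1 - Q).mulVec y) with hw
  have hsplit : (E + (1 - P) * G * (1 - Q)).mulVec y = E.mulVec y + (1 - P).mulVec w := by
    rw [Matrix.add_mulVec, hw, Matrix.mulVec_mulVec, Matrix.mulVec_mulVec]
  have horth : E.mulVec y ⬝ᵥ (1 - P).mulVec w = 0 := by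
    rw [dotProduct_mulVec_eq_transpose, Matrix.transpose_sub, hPt, Matrix.transpose_one,
      Matrix.mulVec_mulVec, Matrix.sub_mul, hPE, Matrix.one_mul, sub_self,
      Matrix.zero_mulVec, zero_dotProduct]
  have hEE : E.mulVec y ⬝ᵥ E.mulVec y = Q.mulVec y ⬝ᵥ Q.mulVec y := by
    rw [dotProduct_mulVec_eq_transpose, Matrix.mulVec_mulVec, hE,
      dotProduct_mulVec_eq_transpose Q, hQt, Matrix.mulVec_mulVec, hQ]
  have hw1 := dotProduct_self_eq_add_of_projection hPt hP w
  have hw2 : 0 ≤ P.mulVec w ⬝ᵥ P.mulVec w := by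
    simpa using dotProduct_star_self_nonneg (P.mulVec w)
  have hw3 := hG ((1 - Q).mulVec y)
  rw [hsplit, dotProduct_self_eq_add_of_projection hQt hQ y, add_dotProduct, dotProduct_add,
    dotProduct_add, dotProduct_comm ((1 - P).mulVec w) (E.mulVec y), horth, hEE]
  linarith

/-! ### The objective as a bilinear pairing -/

theorem objective_eq_trace {m n : ℕ} (A Y : Matrix (Fin m) (Fin n) ℝ) :
    objective A Y = (A.transpose * Y).trace := by
  simp only [objective, Matrix.trace, Matrix.diag, Matrix.mul_apply, Matrix.transpose_apply]
  exact Finset.sum_comm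

theorem objective_add_left {m n : ℕ} (A B Y : Matrix (Fin m) (Fin n) ℝ) :
    objective (A + B) Y = objective A Y + objective B Y := by
  simp [objective_eq_trace, Matrix.add_mul]

theorem objective_smul_left {m n : ℕ} (c : ℝ) (A Y : Matrix (Fin m) (Fin n) ℝ) :
    objective (c • A) Y = c * objective A Y := by
  simp [objective_eq_trace]

theorem objective_sub_right {m n : ℕ} (A Y Z : Matrix (Fin m) (Fin n) ℝ) :
    objective A (Y - Z) = objective A Y - objective A Z := by
  simp [objective_eq_trace, Matrix.mul_sub]

/-- Hölder's inequality between the entrywise supremum norm and the entrywise `ℓ¹` norm. -/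
theorem neg_le_objective_of_abs_le {m n : ℕ} {A : Matrix (Fin m) (Fin n) ℝ} {c : ℝ}
    (hA : ∀ i j, |A i j| ≤ c) (Y : Matrix (Fin m) (Fin n) ℝ) :
    -(c * ∑ i, ∑ j, |Y i j|) ≤ objective A Y := by
  rw [objective, Finset.mul_sum, ← Finset.sum_neg_distrib]
  refine Finset.sum_le_sum fun i _ => ?_
  rw [Finset.mul_sum, ← Finset.sum_neg_distrib]
  refine Finset.sum_le_sum fun j _ => ?_
  have h1 := neg_abs_le (A i j * Y i j)
  rw [abs_mul] at h1
  have h2 := mul_le_mul_of_nonneg_right (hA i j) (abs_nonneg (Y i j))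
  linarith

/-! ### Bi-clustering matrices -/

/-- The matrix whose `m`-th column is the indicator vector of `C m`. -/
def clusterIndicator {n r : ℕ} (C : Fin r → Finset (Fin n)) : Matrix (Fin n) (Fin r) ℝ :=
  Matrix.of fun i m => if i ∈ C m then 1 else 0

theorem IsClusterFamily.transpose_mul_clusterIndicator {n r K : ℕ} {C : Fin r → Finset (Fin n)}
    (hC : IsClusterFamily K C) :
    (clusterIndicator C).transpose * clusterIndicator C = (K : ℝ) • 1 := by
  ext m m'
  simp only [Matrix.mul_apply, Matrix.transpose_apply, clusterIndicator, Matrix.of_apply,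
    Matrix.smul_apply, Matrix.one_apply, ite_mul, one_mul, zero_mul]
  by_cases h : m = m'
  · subst h
    simp only [if_true, smul_eq_mul, mul_one]
    rw [← hC.card_eq m, Finset.card_eq_sum_ones, Nat.cast_sum, ← Finset.sum_filter]
    refine Finset.sum_congr (by ext; simp) fun i hi => by simp [hi]
  · rw [if_neg h, smul_zero]
    refine Finset.sum_eq_zero fun i _ => ?_
    by_cases hi : i ∈ C m
    · rw [if_pos hi, if_neg (Finset.disjoint_left.1 (hC.disjoint m m' h) hi)]
    · rw [if_neg hi]

/-- Since the sets `C m` are disjoint, at most one `m` contributes to an entry of the product. -/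
theorem IsClusterFamily.biclusteringMatrix_eq {nL nR r K : ℕ} {C : Fin r → Finset (Fin nL)}
    (hC : IsClusterFamily K C) (D : Fin r → Finset (Fin nR)) :
    biclusteringMatrix C D = clusterIndicator C * (clusterIndicator D).transpose := by
  ext i j
  simp only [Matrix.mul_apply, Matrix.transpose_apply, clusterIndicator, biclusteringMatrix,
    Matrix.of_apply, ite_mul, one_mul, zero_mul]
  split_ifs with h
  · obtain ⟨m, hi, hj⟩ := h
    rw [Finset.sum_eq_single m]
    · rw [if_pos hi, if_pos hj]
    · intro m' _ hne
      rw [if_neg fun hi' => Finset.disjoint_left.1 (hC.disjoint m' m hne) hi' hi]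
    · simp
  · refine (Finset.sum_eq_zero fun m _ => ?_).symm
    by_cases hi : i ∈ C m
    · rw [if_pos hi, if_neg fun hj => h ⟨m, hi, hj⟩]
    · rw [if_neg hi]

theorem transpose_biclusteringMatrix {nL nR r : ℕ} (C : Fin r → Finset (Fin nL))
    (D : Fin r → Finset (Fin nR)) :
    (biclusteringMatrix C D).transpose = biclusteringMatrix D C := by
  ext i j
  simp only [biclusteringMatrix, Matrix.transpose_apply, Matrix.of_apply, and_comm]

theorem IsClusterFamily.biclusteringMatrix_mul {n₁ n₂ n₃ r K K' : ℕ}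
    {C : Fin r → Finset (Fin n₁)} {D : Fin r → Finset (Fin n₂)} (hC : IsClusterFamily K C)
    (hD : IsClusterFamily K' D) (F : Fin r → Finset (Fin n₃)) :
    biclusteringMatrix C D * biclusteringMatrix D F = (K' : ℝ) • biclusteringMatrix C F := by
  rw [hC.biclusteringMatrix_eq, hD.biclusteringMatrix_eq, hC.biclusteringMatrix_eq,
    Matrix.mul_assoc, ← Matrix.mul_assoc (clusterIndicator D).transpose,
    hD.transpose_mul_clusterIndicator]
  simp

theorem biclusteringMatrix_eq_zero_or_one {nL nR r : ℕ} (C : Fin r → Finset (Fin nL))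
    (D : Fin r → Finset (Fin nR)) (i : Fin nL) (j : Fin nR) :
    biclusteringMatrix C D i j = 0 ∨ biclusteringMatrix C D i j = 1 := by
  simp only [biclusteringMatrix, Matrix.of_apply]
  split_ifs <;> simp

theorem IsClusterFamily.sum_clusterIndicator {n r K : ℕ} {C : Fin r → Finset (Fin n)}
    (hC : IsClusterFamily K C) (m : Fin r) : ∑ i, clusterIndicator C i m = K := by
  simp [clusterIndicator, hC.card_eq]

theorem IsClusterFamily.sum_biclusteringMatrix {nL nR r KL KR : ℕ} {C : Fin r → Finset (Fin nL)}
    {D : Fin r → Finset (Fin nR)} (hC : IsClusterFamily KL C) (hD : IsClusterFamily KR D) :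
    ∑ i, ∑ j, biclusteringMatrix C D i j = (r : ℝ) * KL * KR := by
  simp only [hC.biclusteringMatrix_eq, Matrix.mul_apply, Matrix.transpose_apply]
  calc ∑ i, ∑ j, ∑ m, clusterIndicator C i m * clusterIndicator D j m
      = ∑ i, ∑ m, clusterIndicator C i m * KR := by
        refine Finset.sum_congr rfl fun i _ => ?_
        rw [Finset.sum_comm]
        refine Finset.sum_congr rfl fun m _ => ?_
        rw [← Finset.mul_sum, hD.sum_clusterIndicator]
    _ = ∑ m : Fin r, (KL : ℝ) * KR := by
        rw [Finset.sum_comm]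
        refine Finset.sum_congr rfl fun m _ => ?_
        rw [← Finset.sum_mul, hC.sum_clusterIndicator]
    _ = _ := by simp [mul_assoc]

/-- The matrix that averages over the cluster containing an index, and kills indices outside all
clusters. For `K > 0` and a cluster family `C` of size `K` it is the orthogonal projection onto the
span of the cluster indicators. -/
noncomputable def clusterProjection {n r : ℕ} (K : ℕ) (C : Fin r → Finset (Fin n)) :
    Matrix (Fin n) (Fin n) ℝ :=
  (K : ℝ)⁻¹ • biclusteringMatrix C C

theorem transpose_clusterProjection {n r : ℕ} (K : ℕ) (C : Fin r → Finset (Fin n)) :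
    (clusterProjection K C).transpose = clusterProjection K C := by
  rw [clusterProjection, Matrix.transpose_smul, transpose_biclusteringMatrix]

theorem clusterProjection_apply_comm {n r : ℕ} (K : ℕ) (C : Fin r → Finset (Fin n))
    (i j : Fin n) : clusterProjection K C i j = clusterProjection K C j i :=
  congrFun (congrFun (transpose_clusterProjection K C) j) i

section

variable {nL nR r KL KR : ℕ} {C : Fin r → Finset (Fin nL)} {D : Fin r → Finset (Fin nR)}

theorem IsClusterFamily.clusterProjection_mul_biclusteringMatrix (hC : IsClusterFamily KL C)
    (hKL : 0 < KL) (D : Fin r → Finset (Fin nR)) :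
    clusterProjection KL C * biclusteringMatrix C D = biclusteringMatrix C D := by
  have : (KL : ℝ) ≠ 0 := by positivity
  rw [clusterProjection, Matrix.smul_mul, hC.biclusteringMatrix_mul hC, smul_smul,
    inv_mul_cancel₀ this, one_smul]

theorem IsClusterFamily.clusterProjection_mul_self (hC : IsClusterFamily KL C) (hKL : 0 < KL) :
    clusterProjection KL C * clusterProjection KL C = clusterProjection KL C := by
  conv_lhs => arg 2; rw [clusterProjection]
  rw [Matrix.mul_smul, hC.clusterProjection_mul_biclusteringMatrix hKL, clusterProjection]

theorem clusterProjection_apply_le (KL : ℕ) (C : Fin r → Finset (Fin nL)) (i j : Fin nL) :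
    clusterProjection KL C i j ≤ (KL : ℝ)⁻¹ := by
  rw [clusterProjection, Matrix.smul_apply]
  rcases biclusteringMatrix_eq_zero_or_one C C i j with h | h <;> rw [h] <;> simp

theorem clusterProjection_apply_nonneg (KL : ℕ) (C : Fin r → Finset (Fin nL)) (i j : Fin nL) :
    0 ≤ clusterProjection KL C i j := by
  rw [clusterProjection, Matrix.smul_apply]
  rcases biclusteringMatrix_eq_zero_or_one C C i j with h | h <;> rw [h] <;> simp

theorem IsClusterFamily.sum_sq_clusterProjection_le (hC : IsClusterFamily KL C) (hKL : 0 < KL)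
    (i : Fin nL) : ∑ k, clusterProjection KL C k i ^ 2 ≤ (KL : ℝ)⁻¹ := by
  have h1 := congrFun (congrFun (hC.clusterProjection_mul_self hKL) i) i
  rw [Matrix.mul_apply] at h1
  refine le_trans (le_of_eq ?_) (h1.trans_le (clusterProjection_apply_le KL C i i))
  refine Finset.sum_congr rfl fun k _ => ?_
  rw [sq]
  congr 1
  exact clusterProjection_apply_comm KL C k i

theorem IsClusterFamily.sum_clusterProjection_le_one (hC : IsClusterFamily KL C) (hKL : 0 < KL)
    (i : Fin nL) : ∑ k, clusterProjection KL C k i ≤ 1 := by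
  have hK : (0 : ℝ) < KL := by positivity
  have h1 : ∀ k, clusterProjection KL C k i = KL * clusterProjection KL C k i ^ 2 := by
    intro k
    rw [clusterProjection, Matrix.smul_apply]
    rcases biclusteringMatrix_eq_zero_or_one C C k i with h | h <;> rw [h]
    · simp
    · simp only [smul_eq_mul, mul_one]; field_simp
  calc ∑ k, clusterProjection KL C k i = KL * ∑ k, clusterProjection KL C k i ^ 2 := by
        rw [Finset.mul_sum]; exact Finset.sum_congr rfl fun k _ => h1 k
    _ ≤ KL * (KL : ℝ)⁻¹ := by gcongr; exact hC.sum_sq_clusterProjection_le hKL i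
    _ = 1 := mul_inv_cancel₀ hK.ne'

theorem IsClusterFamily.objective_biclusteringMatrix_self (hC : IsClusterFamily KL C)
    (hD : IsClusterFamily KR D) :
    objective (biclusteringMatrix C D) (biclusteringMatrix C D) = (r : ℝ) * KL * KR := by
  rw [← hC.sum_biclusteringMatrix hD, objective]
  refine Finset.sum_congr rfl fun i _ => Finset.sum_congr rfl fun j _ => ?_
  rcases biclusteringMatrix_eq_zero_or_one C D i j with h | h <;> simp [h]

theorem IsClusterFamily.traceNorm_biclusteringMatrix (hC : IsClusterFamily KL C)
    (hD : IsClusterFamily KR D) (hKL : 0 < KL) (hKR : 0 < KR) :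
    traceNorm (biclusteringMatrix C D) = r * √((KL : ℝ) * KR) := by
  have hs : 0 < √((KL : ℝ) * KR) := by positivity
  have hss : √((KL : ℝ) * KR) ^ 2 = KL * KR := Real.sq_sqrt (by positivity)
  have h := mul_traceNorm_eq_sum_sq (Y := biclusteringMatrix C D) hs.le (by
    rw [hss, transpose_biclusteringMatrix, hD.biclusteringMatrix_mul hC, Matrix.smul_mul,
      Matrix.mul_smul, hD.biclusteringMatrix_mul hD, smul_smul, smul_smul, smul_smul]
    congr 1
    ring)
  have h2 := hC.objective_biclusteringMatrix_self hD
  rw [objective] at h2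
  refine mul_left_cancel₀ hs.ne' ?_
  rw [h, h2]
  linear_combination -(r : ℝ) * hss

theorem IsClusterFamily.biclusteringMatrix_mem_feasibleSet (hC : IsClusterFamily KL C)
    (hD : IsClusterFamily KR D) (hKL : 0 < KL) (hKR : 0 < KR) :
    biclusteringMatrix C D ∈ feasibleSet nL nR KL KR r := by
  refine ⟨(hC.traceNorm_biclusteringMatrix hD hKL hKR).le, hC.sum_biclusteringMatrix hD, ?_⟩
  intro i j
  rcases biclusteringMatrix_eq_zero_or_one C D i j with h | h <;> simp [h]

/-- As `Y` and the bi-clustering matrix have equal sums, the mass that `Y` misses on the planted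
support equals the mass it has off the support. -/
theorem IsClusterFamily.sum_abs_biclusteringMatrix_sub (hC : IsClusterFamily KL C)
    (hD : IsClusterFamily KR D) {Y : Matrix (Fin nL) (Fin nR) ℝ}
    (hY : Y ∈ feasibleSet nL nR KL KR r) :
    ∑ i, ∑ j, |(biclusteringMatrix C D - Y) i j| =
      2 * objective (biclusteringMatrix C D) (biclusteringMatrix C D - Y) := by
  have h1 : ∀ i j, |(biclusteringMatrix C D - Y) i j| =
      2 * (biclusteringMatrix C D i j * (biclusteringMatrix C D - Y) i j) +
        (Y i j - biclusteringMatrix C D i j) := by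
    intro i j
    obtain ⟨h0, h1⟩ := hY.2.2 i j
    rw [Matrix.sub_apply]
    rcases biclusteringMatrix_eq_zero_or_one C D i j with h | h <;> rw [h]
    · rw [abs_of_nonpos (by linarith)]; ring
    · rw [abs_of_nonneg (by linarith)]; ring
  simp only [h1, Finset.sum_add_distrib, Finset.sum_sub_distrib, hY.2.1,
    hC.sum_biclusteringMatrix hD, objective, Finset.mul_sum, sub_self, add_zero]

/-- The normalized bi-clustering matrix, perturbed by a contraction that lives on the complements
of the row and column cluster spaces, is a contraction; this makes it a subgradient of the trace
norm at the bi-clustering matrix. -/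
theorem IsClusterFamily.isContraction_certificate (hC : IsClusterFamily KL C)
    (hD : IsClusterFamily KR D) (hKL : 0 < KL) (hKR : 0 < KR)
    {G : Matrix (Fin nL) (Fin nR) ℝ} (hG : IsContraction G) :
    IsContraction ((√((KL : ℝ) * KR))⁻¹ • biclusteringMatrix C D +
      (1 - clusterProjection KL C) * G * (1 - clusterProjection KR D)) := by
  have hss : √((KL : ℝ) * KR) * √((KL : ℝ) * KR) = KL * KR := Real.mul_self_sqrt (by positivity)
  have hKL' : (KL : ℝ) ≠ 0 := by positivity
  refine IsContraction.add_compl_mul_mul_compl (transpose_clusterProjection KL C)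
    (hC.clusterProjection_mul_self hKL) (transpose_clusterProjection KR D)
    (hD.clusterProjection_mul_self hKR) ?_ ?_ hG
  · rw [Matrix.mul_smul, hC.clusterProjection_mul_biclusteringMatrix hKL]
  · rw [Matrix.transpose_smul, Matrix.smul_mul, Matrix.mul_smul, transpose_biclusteringMatrix,
      hD.biclusteringMatrix_mul hC, smul_smul, smul_smul, ← mul_inv, hss, clusterProjection]
    congr 1
    field_simp

/-! ### Deterministic recovery -/

/-- The bi-clustering matrix is the unique maximizer as soon as the noise `N` has operator norm at
most `l`, its averages over row clusters and over column clusters are at most `τ` in absolute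
value, and the signal `μ` beats both. The objective gap to a feasible `Y` is at least
`μ - l / √(KL * KR) - 6 * τ` times the mass of the planted support missed by `Y`. -/
theorem IsClusterFamily.isUniqueMaximizer_of_noise_bounds (hC : IsClusterFamily KL C)
    (hD : IsClusterFamily KR D) (hKL : 0 < KL) (hKR : 0 < KR) {N : Matrix (Fin nL) (Fin nR) ℝ}
    {μ l τ : ℝ} (hl : 0 < l) (hN : ∀ y, N.mulVec y ⬝ᵥ N.mulVec y ≤ l ^ 2 * (y ⬝ᵥ y))
    (hNL : ∀ i j, |(clusterProjection KL C * N) i j| ≤ τ)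
    (hNR : ∀ i j, |(N * clusterProjection KR D) i j| ≤ τ)
    (hμ : l / √((KL : ℝ) * KR) + 6 * τ < μ) :
    IsUniqueMaximizer (objective (μ • biclusteringMatrix C D + N)) (feasibleSet nL nR KL KR r)
      (biclusteringMatrix C D) := by
  set Ys := biclusteringMatrix C D with hYs
  set PL := clusterProjection KL C with hPL
  set PR := clusterProjection KR D with hPR
  set κ := √((KL : ℝ) * KR) with hκ
  have hκ0 : 0 < κ := by positivity
  have hκκ : κ * κ = KL * KR := Real.mul_self_sqrt (by positivity)
  have hmem : Ys ∈ feasibleSet nL nR KL KR r :=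
    hC.biclusteringMatrix_mem_feasibleSet hD hKL hKR
  set W := (1 - PL) * N * (1 - PR) with hW
  have hcert : IsContraction (κ⁻¹ • Ys + l⁻¹ • W) := by
    have hG : IsContraction (l⁻¹ • N) := by
      intro y
      rw [Matrix.smul_mulVec, smul_dotProduct, dotProduct_smul, smul_eq_mul, smul_eq_mul,
        ← mul_assoc]
      calc l⁻¹ * l⁻¹ * (N.mulVec y ⬝ᵥ N.mulVec y) ≤ l⁻¹ * l⁻¹ * (l ^ 2 * (y ⬝ᵥ y)) := by
            gcongr; exact hN y
        _ = y ⬝ᵥ y := by field_simp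
    have h := hC.isContraction_certificate hD hKL hKR hG
    rwa [Matrix.mul_smul, Matrix.smul_mul] at h
  have hWY : objective W Ys = 0 := by
    have h1 : (1 - PL) * Ys = 0 := by
      rw [Matrix.sub_mul, Matrix.one_mul, hC.clusterProjection_mul_biclusteringMatrix hKL, sub_self]
    have h2 : W.transpose * Ys = (N * (1 - PR)).transpose * ((1 - PL) * Ys) := by
      rw [hW, Matrix.mul_assoc (1 - PL), Matrix.transpose_mul (1 - PL), Matrix.transpose_sub,
        Matrix.transpose_one, transpose_clusterProjection, Matrix.mul_assoc]
    rw [objective_eq_trace, h2, h1, Matrix.mul_zero, Matrix.trace_zero]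
  -- the component of the noise in the tangent space is entrywise small
  have hbound : ∀ i j, |(PL * N + (N * PR - PL * N * PR)) i j| ≤ 3 * τ := by
    intro i j
    have h3 : |(PL * N * PR) i j| ≤ τ := by
      have hτ : 0 ≤ τ := (abs_nonneg _).trans (hNL i j)
      rw [Matrix.mul_apply]
      calc |∑ k, (PL * N) i k * PR k j| ≤ ∑ k, τ * PR k j := by
            refine (Finset.abs_sum_le_sum_abs _ _).trans (Finset.sum_le_sum fun k _ => ?_)
            rw [abs_mul, abs_of_nonneg (clusterProjection_apply_nonneg KR D k j)]
            exact mul_le_mul_of_nonneg_right (hNL i k) (clusterProjection_apply_nonneg KR D k j)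
        _ = τ * ∑ k, PR k j := (Finset.mul_sum _ _ _).symm
        _ ≤ τ * 1 := by gcongr; exact hD.sum_clusterProjection_le_one hKR j
        _ = τ := mul_one τ
    have h1 := abs_le.1 (hNL i j)
    have h2 := abs_le.1 (hNR i j)
    have h3 := abs_le.1 h3
    rw [Matrix.add_apply, Matrix.sub_apply, abs_le]
    constructor <;> linarith [h1.1, h1.2, h2.1, h2.2, h3.1, h3.2]
  have hdecomp : N = W + (PL * N + (N * PR - PL * N * PR)) := by
    simp only [hW, Matrix.sub_mul, Matrix.mul_sub, Matrix.one_mul, Matrix.mul_one]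
    abel
  have hgap : ∀ Y ∈ feasibleSet nL nR KL KR r,
      (μ - l / κ - 6 * τ) * objective Ys (Ys - Y) ≤
        objective (μ • Ys + N) Ys - objective (μ • Ys + N) Y := by
    intro Y hY
    -- the certificate pairs with `Ys` to exactly the trace norm budget `r * κ`
    have h1 : objective (κ⁻¹ • Ys + l⁻¹ • W) Y ≤ r * κ :=
      (hcert.sum_mul_le_traceNorm Y).trans hY.1
    have h2 : objective (κ⁻¹ • Ys + l⁻¹ • W) Ys = r * κ := by
      rw [objective_add_left, objective_smul_left, objective_smul_left, hWY, mul_zero, add_zero,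
        hC.objective_biclusteringMatrix_self hD]
      field_simp
      linear_combination -(r : ℝ) * hκκ
    have h3 : 0 ≤ κ⁻¹ * objective Ys (Ys - Y) + l⁻¹ * objective W (Ys - Y) := by
      rw [← objective_smul_left, ← objective_smul_left, ← objective_add_left,
        objective_sub_right]
      linarith
    have h4 : -(l / κ * objective Ys (Ys - Y)) ≤ objective W (Ys - Y) := by
      have h5 := mul_nonneg hl.le h3
      have h6 : l * (κ⁻¹ * objective Ys (Ys - Y) + l⁻¹ * objective W (Ys - Y)) =
          l / κ * objective Ys (Ys - Y) + objective W (Ys - Y) := by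
        field_simp
      linarith
    have h7 := neg_le_objective_of_abs_le hbound (Ys - Y)
    rw [hC.sum_abs_biclusteringMatrix_sub hD hY] at h7
    rw [← objective_sub_right, objective_add_left, objective_smul_left]
    conv_rhs => arg 2; rw [hdecomp, objective_add_left]
    linarith
  have hcoef : 0 < μ - l / κ - 6 * τ := by linarith
  have hnn : ∀ Y ∈ feasibleSet nL nR KL KR r, 0 ≤ objective Ys (Ys - Y) := by
    intro Y hY
    have h1 := hC.sum_abs_biclusteringMatrix_sub hD hY
    have h2 : 0 ≤ ∑ i, ∑ j, |(Ys - Y) i j| :=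
      Finset.sum_nonneg fun i _ => Finset.sum_nonneg fun j _ => abs_nonneg _
    linarith
  refine ⟨⟨hmem, fun Y hY => ?_⟩, fun Y ⟨hY, hmax⟩ => ?_⟩
  · have := hgap Y hY
    have := mul_nonneg hcoef.le (hnn Y hY)
    show objective _ Y ≤ objective _ Ys
    linarith
  · have h1 := hgap Y hY
    have h2 : objective (μ • Ys + N) Ys ≤ objective (μ • Ys + N) Y := hmax hmem
    have h3 : objective Ys (Ys - Y) = 0 :=
      le_antisymm (nonpos_of_mul_nonpos_right (by linarith) hcoef) (hnn Y hY)
    have h4 := hC.sum_abs_biclusteringMatrix_sub hD hY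
    rw [← hYs, h3, mul_zero, Finset.sum_eq_zero_iff_of_nonneg
      (fun i _ => Finset.sum_nonneg fun j _ => abs_nonneg _)] at h4
    ext i j
    have h5 := (Finset.sum_eq_zero_iff_of_nonneg (fun j _ => abs_nonneg _)).1
      (h4 i (Finset.mem_univ i)) j (Finset.mem_univ j)
    rw [abs_eq_zero, Matrix.sub_apply] at h5
    linarith

end

/-! ### Tail bounds for the noise -/

theorem measureReal_abs_ge_le_of_hasSubgaussianMGF {Ω : Type*} [MeasurableSpace Ω]
    {P : Measure Ω} [IsFiniteMeasure P] {X : Ω → ℝ} {c : NNReal} (hX : HasSubgaussianMGF X c P)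
    {t : ℝ} (ht : 0 ≤ t) :
    P.real {ω | t ≤ |X ω|} ≤ 2 * Real.exp (-t ^ 2 / (2 * c)) := by
  have hsub : {ω | t ≤ |X ω|} ⊆ {ω | t ≤ X ω} ∪ {ω | t ≤ (-X) ω} := fun ω hω =>
    (le_abs (a := t) (b := X ω)).1 hω
  calc P.real {ω | t ≤ |X ω|} ≤ P.real ({ω | t ≤ X ω} ∪ {ω | t ≤ (-X) ω}) :=
        measureReal_mono hsub
    _ ≤ P.real {ω | t ≤ X ω} + P.real {ω | t ≤ (-X) ω} := measureReal_union_le _ _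
    _ ≤ Real.exp (-t ^ 2 / (2 * c)) + Real.exp (-t ^ 2 / (2 * c)) :=
        add_le_add (hX.measure_ge_le ht) (hX.neg.measure_ge_le ht)
    _ = _ := by ring

theorem measureReal_biUnion_le_card_mul {Ω ι : Type*} [MeasurableSpace Ω]
    {P : Measure Ω} (s : Finset ι) (A : ι → Set Ω) {ε : ℝ}
    (hA : ∀ i ∈ s, P.real (A i) ≤ ε) : P.real (⋃ i ∈ s, A i) ≤ s.card * ε := by
  refine (measureReal_biUnion_finset_le s A).trans ?_
  rw [← nsmul_eq_mul]
  exact Finset.sum_le_card_nsmul s _ ε hA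

section

variable {Ω : Type*} [MeasurableSpace Ω] {P : Measure Ω} [IsProbabilityMeasure P] {nL nR : ℕ}
  {Δ : Fin nL → Fin nR → Ω → ℝ}

/-- A linear form `∑ w i j * Δ i j` in the noise is sub-Gaussian with variance proxy `∑ w i j ^ 2`.
The bound `v` on this proxy may be strict, so that the zero form is covered as well. -/
theorem IsSubGaussianNoise.measureReal_abs_sum_ge_le (hΔ : IsSubGaussianNoise Δ P)
    (w : Fin nL → Fin nR → ℝ) {v t : ℝ} (hv : 0 ≤ v) (hw : ∑ i, ∑ j, w i j ^ 2 ≤ v)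
    (ht : 0 ≤ t) :
    P.real {ω | t ≤ |∑ i, ∑ j, w i j * Δ i j ω|} ≤ 2 * Real.exp (-t ^ 2 / (2 * v)) := by
  have hsub : ∀ p : Fin nL × Fin nR, HasSubgaussianMGF (fun ω => w p.1 p.2 * Δ p.1 p.2 ω)
      (⟨w p.1 p.2 ^ 2, sq_nonneg _⟩ * 1) P := fun p => (hΔ.subGaussian p.1 p.2).const_mul _
  have hind : iIndepFun (fun (p : Fin nL × Fin nR) ω => w p.1 p.2 * Δ p.1 p.2 ω) P :=
    hΔ.indep.comp (fun p x => w p.1 p.2 * x) fun p => measurable_const_mul _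
  have hsum := HasSubgaussianMGF.sum_of_iIndepFun hind (s := Finset.univ) fun p _ => hsub p
  have hX : HasSubgaussianMGF (fun ω => ∑ p : Fin nL × Fin nR, w p.1 p.2 * Δ p.1 p.2 ω)
      ⟨v, hv⟩ P := by
    refine ⟨hsum.integrable_exp_mul, fun s => (hsum.mgf_le s).trans (Real.exp_le_exp.2 ?_)⟩
    have hle : ((∑ p : Fin nL × Fin nR, (⟨w p.1 p.2 ^ 2, sq_nonneg _⟩ * 1 : NNReal) : NNReal) : ℝ)
        ≤ v := by
      rw [NNReal.coe_sum, Fintype.sum_prod_type]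
      refine (Finset.sum_le_sum fun i _ => Finset.sum_le_sum fun j _ => le_of_eq ?_).trans hw
      exact mul_one (w i j ^ 2)
    change _ ≤ v * s ^ 2 / 2
    gcongr
  have h := measureReal_abs_ge_le_of_hasSubgaussianMGF hX ht
  simp only [Fintype.sum_prod_type] at h
  exact h

theorem IsSubGaussianNoise.measureReal_abs_bilin_ge_le (hΔ : IsSubGaussianNoise Δ P)
    {x : EuclideanSpace ℝ (Fin nL)} {y : EuclideanSpace ℝ (Fin nR)} (hx : ‖x‖ ≤ 1)
    (hy : ‖y‖ ≤ 1) {t : ℝ} (ht : 0 ≤ t) :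
    P.real {ω | t ≤ |x.ofLp ⬝ᵥ (Matrix.of fun i j => Δ i j ω).mulVec y.ofLp|} ≤
      2 * Real.exp (-t ^ 2 / 2) := by
  have hw : ∑ i, ∑ j, (x i * y j) ^ 2 ≤ 1 := by
    simp only [mul_pow]
    rw [← Finset.sum_mul_sum, ← EuclideanSpace.real_norm_sq_eq, ← EuclideanSpace.real_norm_sq_eq]
    exact mul_le_one₀ (pow_le_one₀ (norm_nonneg _) hx) (by positivity)
      (pow_le_one₀ (norm_nonneg _) hy)
  have h := hΔ.measureReal_abs_sum_ge_le (fun i j => x i * y j) zero_le_one hw ht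
  rw [mul_one] at h
  convert h using 6 with ω
  simp only [dotProduct, Matrix.mulVec, Matrix.of_apply, Finset.mul_sum]
  exact Finset.sum_congr rfl fun i _ => Finset.sum_congr rfl fun j _ => by ring

variable {r KL KR : ℕ} {C : Fin r → Finset (Fin nL)} {D : Fin r → Finset (Fin nR)}

theorem IsSubGaussianNoise.measureReal_abs_projection_mul_ge_le (hΔ : IsSubGaussianNoise Δ P)
    (hC : IsClusterFamily KL C) (hKL : 0 < KL) (i : Fin nL) (j : Fin nR) {t : ℝ} (ht : 0 ≤ t) :
    P.real {ω | t ≤ |(clusterProjection KL C * Matrix.of fun i j => Δ i j ω) i j|} ≤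
      2 * Real.exp (-t ^ 2 / (2 * (KL : ℝ)⁻¹)) := by
  have hw : ∑ i', ∑ j', (if j' = j then clusterProjection KL C i' i else 0) ^ 2
      ≤ (KL : ℝ)⁻¹ := by
    simpa using hC.sum_sq_clusterProjection_le hKL i
  have h := hΔ.measureReal_abs_sum_ge_le _ (by positivity) hw ht
  convert h using 6 with ω
  rw [Matrix.mul_apply]
  refine Finset.sum_congr rfl fun k _ => ?_
  rw [clusterProjection_apply_comm]
  simp

theorem IsSubGaussianNoise.measureReal_abs_mul_projection_ge_le (hΔ : IsSubGaussianNoise Δ P)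
    (hD : IsClusterFamily KR D) (hKR : 0 < KR) (i : Fin nL) (j : Fin nR) {t : ℝ} (ht : 0 ≤ t) :
    P.real {ω | t ≤ |((Matrix.of fun i j => Δ i j ω) * clusterProjection KR D) i j|} ≤
      2 * Real.exp (-t ^ 2 / (2 * (KR : ℝ)⁻¹)) := by
  have hw : ∑ i', ∑ j', (if i' = i then clusterProjection KR D j' j else 0) ^ 2
      ≤ (KR : ℝ)⁻¹ := by
    rw [Finset.sum_comm]
    simpa using hD.sum_sq_clusterProjection_le hKR j
  have h := hΔ.measureReal_abs_sum_ge_le _ (by positivity) hw ht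
  convert h using 6 with ω
  rw [Matrix.mul_apply, Finset.sum_comm]
  refine Finset.sum_congr rfl fun k _ => ?_
  simp [mul_comm]

/-- The union bound for the three noise estimates of the deterministic recovery criterion. Two half
nets have at most `5 ^ nL * 5 ^ nR ≤ 25 ^ n` pairs of points, and the two averaged noise matrices
have at most `2 * n ^ 2` entries, each zero or an average of at least `min KL KR` noise variables. -/
theorem IsSubGaussianNoise.measureReal_noise_bounds_compl_le (hΔ : IsSubGaussianNoise Δ P)
    (hC : IsClusterFamily KL C) (hD : IsClusterFamily KR D) (hKL : 0 < KL) (hKR : 0 < KR)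
    {t τ : ℝ} (ht : 0 ≤ t) (hτ : 0 ≤ τ) :
    P.real {ω | ¬ ((∀ y, (Matrix.of fun i j => Δ i j ω).mulVec y ⬝ᵥ
            (Matrix.of fun i j => Δ i j ω).mulVec y ≤ (4 * t) ^ 2 * (y ⬝ᵥ y)) ∧
          (∀ i j, |(clusterProjection KL C * Matrix.of fun i j => Δ i j ω) i j| ≤ τ) ∧
          ∀ i j, |((Matrix.of fun i j => Δ i j ω) * clusterProjection KR D) i j| ≤ τ)} ≤
      2 * 25 ^ max nL nR * Real.exp (-t ^ 2 / 2) +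
        4 * (max nL nR : ℕ) ^ 2 * Real.exp (-(τ ^ 2 * (min KL KR : ℕ)) / 2) := by
  obtain ⟨NL, hNLc, hNL1, hNL⟩ := exists_half_net (EuclideanSpace ℝ (Fin nL))
  obtain ⟨NR, hNRc, hNR1, hNR⟩ := exists_half_net (EuclideanSpace ℝ (Fin nR))
  rw [finrank_euclideanSpace_fin] at hNLc hNRc
  set n := max nL nR with hn
  set e := Real.exp (-(τ ^ 2 * (min KL KR : ℕ)) / 2) with he
  have hexp : ∀ K : ℕ, min KL KR ≤ K →
      2 * Real.exp (-τ ^ 2 / (2 * (K : ℝ)⁻¹)) ≤ 2 * e := by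
    intro K hK
    have h1 : -τ ^ 2 / (2 * (K : ℝ)⁻¹) = -(τ ^ 2 * K) / 2 := by
      rw [mul_comm, ← div_div, div_inv_eq_mul]; ring
    rw [h1]
    rw [he]
    gcongr
  let A₁ : Set Ω := ⋃ p ∈ NL ×ˢ NR,
    {ω | t ≤ |p.1.ofLp ⬝ᵥ (Matrix.of fun i j => Δ i j ω).mulVec p.2.ofLp|}
  let A₂ : Set Ω := ⋃ p ∈ (Finset.univ : Finset (Fin nL × Fin nR)),
    {ω | τ ≤ |(clusterProjection KL C * Matrix.of fun i j => Δ i j ω) p.1 p.2|}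
  let A₃ : Set Ω := ⋃ p ∈ (Finset.univ : Finset (Fin nL × Fin nR)),
    {ω | τ ≤ |((Matrix.of fun i j => Δ i j ω) * clusterProjection KR D) p.1 p.2|}
  have h₁ : P.real A₁ ≤ 2 * 25 ^ n * Real.exp (-t ^ 2 / 2) := by
    have hcard : (((NL ×ˢ NR).card : ℕ) : ℝ) ≤ 25 ^ n := by
      have : (NL ×ˢ NR).card ≤ 25 ^ n := by
        rw [Finset.card_product]
        calc NL.card * NR.card ≤ 5 ^ n * 5 ^ n := Nat.mul_le_mul
              (hNLc.trans (Nat.pow_le_pow_right (by norm_num) (le_max_left _ _)))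
              (hNRc.trans (Nat.pow_le_pow_right (by norm_num) (le_max_right _ _)))
          _ = 25 ^ n := by rw [← mul_pow]; norm_num
      exact_mod_cast this
    refine (measureReal_biUnion_le_card_mul (NL ×ˢ NR) _ fun p hp => ?_).trans
      ((mul_le_mul_of_nonneg_right hcard
        (by positivity : 0 ≤ 2 * Real.exp (-t ^ 2 / 2))).trans_eq (by ring))
    rw [Finset.mem_product] at hp
    exact hΔ.measureReal_abs_bilin_ge_le (hNL1 _ hp.1) (hNR1 _ hp.2) ht
  have hcard : (((Finset.univ : Finset (Fin nL × Fin nR)).card : ℕ) : ℝ) ≤ (n : ℝ) ^ 2 := by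
    rw [Finset.card_univ, Fintype.card_prod, Fintype.card_fin, Fintype.card_fin, sq]
    exact_mod_cast Nat.mul_le_mul (le_max_left nL nR) (le_max_right nL nR)
  have h₂ : P.real A₂ ≤ (n : ℝ) ^ 2 * (2 * e) :=
    (measureReal_biUnion_le_card_mul _ _ fun p _ =>
      (hΔ.measureReal_abs_projection_mul_ge_le hC hKL p.1 p.2 hτ).trans
        (hexp KL (min_le_left _ _))).trans (mul_le_mul_of_nonneg_right hcard (by positivity))
  have h₃ : P.real A₃ ≤ (n : ℝ) ^ 2 * (2 * e) :=
    (measureReal_biUnion_le_card_mul _ _ fun p _ =>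
      (hΔ.measureReal_abs_mul_projection_ge_le hD hKR p.1 p.2 hτ).trans
        (hexp KR (min_le_right _ _))).trans (mul_le_mul_of_nonneg_right hcard (by positivity))
  have hsub : {ω | ¬ ((∀ y, (Matrix.of fun i j => Δ i j ω).mulVec y ⬝ᵥ
            (Matrix.of fun i j => Δ i j ω).mulVec y ≤ (4 * t) ^ 2 * (y ⬝ᵥ y)) ∧
          (∀ i j, |(clusterProjection KL C * Matrix.of fun i j => Δ i j ω) i j| ≤ τ) ∧
          ∀ i j, |((Matrix.of fun i j => Δ i j ω) * clusterProjection KR D) i j| ≤ τ)} ⊆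
      A₁ ∪ (A₂ ∪ A₃) := by
    intro ω hω
    by_contra hnot
    simp only [A₁, A₂, A₃, Set.mem_union, Set.mem_iUnion, Set.mem_ofPred_eq, Finset.mem_univ,
      Finset.mem_product, exists_prop, true_and, not_or, not_exists, not_and, not_le,
      Prod.forall] at hnot
    obtain ⟨g₁, g₂, g₃⟩ := hnot
    exact hω ⟨mulVec_dotProduct_le_of_nets _ hNL hNR ht fun x hx y hy => (g₁ x y ⟨hx, hy⟩).le,
      fun i j => (g₂ i j).le, fun i j => (g₃ i j).le⟩
  calc _ ≤ P.real (A₁ ∪ (A₂ ∪ A₃)) := measureReal_mono hsub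
    _ ≤ P.real A₁ + (P.real A₂ + P.real A₃) :=
        (measureReal_union_le _ _).trans (add_le_add_right (measureReal_union_le _ _) _)
    _ ≤ 2 * 25 ^ n * Real.exp (-t ^ 2 / 2) +
        ((n : ℝ) ^ 2 * (2 * e) + (n : ℝ) ^ 2 * (2 * e)) := add_le_add h₁ (add_le_add h₂ h₃)
    _ = _ := by ring

end

/-! ### Exact recovery -/

theorem failure_bound_le_zpow {n : ℕ} (hn : 2 ≤ n) {a b : ℝ} (ha : 16 * (n : ℝ) ≤ a)
    (hb : 16 * Real.log n ≤ b) :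
    2 * 25 ^ n * Real.exp (-a) + 4 * (n : ℝ) ^ 2 * Real.exp (-b) ≤ (n : ℝ) ^ (-10 : ℤ) := by
  have hn2 : (2 : ℝ) ≤ n := by exact_mod_cast hn
  have hn0 : (0 : ℝ) < n := by linarith
  have hz : (n : ℝ) ^ (-10 : ℤ) = ((n : ℝ)⁻¹) ^ 10 := by
    rw [zpow_neg, inv_pow]; norm_cast
  have hinv : (n : ℝ)⁻¹ ≤ 1 / 2 := by
    rw [one_div]; exact inv_anti₀ (by norm_num) hn2
  have hinv0 : 0 < (n : ℝ)⁻¹ := inv_pos.2 hn0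
  have hexpn : Real.exp (-(n : ℝ)) ≤ (n : ℝ)⁻¹ := by
    rw [Real.exp_neg]
    exact inv_anti₀ hn0 (by linarith [Real.add_one_le_exp (n : ℝ)])
  -- `25 ≤ e ^ 4` leaves `e ^ (-12 * n)`, more than enough for `n ^ (-10)`
  have h25 : (25 : ℝ) ≤ Real.exp 4 := by
    have h1 : Real.exp 4 = Real.exp 1 ^ 4 := by rw [← Real.exp_nat_mul]; norm_num
    have h2 : (2.5 : ℝ) ≤ Real.exp 1 := by linarith [Real.exp_one_gt_d9]
    calc (25 : ℝ) ≤ 2.5 ^ 4 := by norm_num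
      _ ≤ Real.exp 1 ^ 4 := by gcongr
      _ = _ := h1.symm
  have hA : 2 * 25 ^ n * Real.exp (-a) ≤ (n : ℝ)⁻¹ ^ 10 / 2 := by
    calc 2 * 25 ^ n * Real.exp (-a)
        ≤ 2 * Real.exp 4 ^ n * Real.exp (-(16 * (n : ℝ))) := by gcongr
      _ = 2 * Real.exp (-(n : ℝ)) ^ 12 := by
          rw [← Real.exp_nat_mul, ← Real.exp_nat_mul, mul_assoc, ← Real.exp_add]
          congr 2
          push_cast
          ring
      _ ≤ 2 * (n : ℝ)⁻¹ ^ 12 := by gcongr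
      _ = 2 * (n : ℝ)⁻¹ ^ 10 * (n : ℝ)⁻¹ ^ 2 := by ring
      _ ≤ 2 * (n : ℝ)⁻¹ ^ 10 * (1 / 2) ^ 2 := by gcongr
      _ = _ := by ring
  have hB : 4 * (n : ℝ) ^ 2 * Real.exp (-b) ≤ (n : ℝ)⁻¹ ^ 10 / 2 := by
    have hlog : Real.exp (-(16 * Real.log n)) = (n : ℝ)⁻¹ ^ 16 := by
      rw [Real.exp_neg, inv_pow, show 16 * Real.log (n : ℝ) = ((16 : ℕ) : ℝ) * Real.log n by
        norm_num, Real.exp_nat_mul, Real.exp_log hn0]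
    calc 4 * (n : ℝ) ^ 2 * Real.exp (-b)
        ≤ 4 * (n : ℝ) ^ 2 * Real.exp (-(16 * Real.log n)) := by gcongr
      _ = 4 * (n : ℝ)⁻¹ ^ 10 * (n : ℝ)⁻¹ ^ 4 := by rw [hlog]; field_simp
      _ ≤ 4 * (n : ℝ)⁻¹ ^ 10 * (1 / 2) ^ 4 := by gcongr
      _ ≤ _ := by nlinarith [pow_pos hinv0 10]
  rw [hz]
  linarith

theorem observedMatrix_eq {Ω : Type*} {nL nR r : ℕ} (μ : ℝ) (C : Fin r → Finset (Fin nL))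
    (D : Fin r → Finset (Fin nR)) (Δ : Fin nL → Fin nR → Ω → ℝ) (ω : Ω) :
    observedMatrix μ C D Δ ω =
      μ • biclusteringMatrix C D + Matrix.of fun i j => Δ i j ω := by
  ext i j
  simp only [observedMatrix, biclusteringMatrix, Matrix.add_apply, Matrix.smul_apply,
    Matrix.of_apply]
  split_ifs <;> simp

/-- No measurability is needed: the inequality uses only subadditivity of the outer measure. -/
theorem one_sub_le_measureReal_of_compl_subset {Ω : Type*} [MeasurableSpace Ω] {P : Measure Ω}
    [IsProbabilityMeasure P] {S B : Set Ω} (h : Sᶜ ⊆ B) : 1 - P.real B ≤ P.real S := by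
  have h1 : P.real (Set.univ : Set Ω) ≤ P.real S + P.real B :=
    (measureReal_mono (by rw [← Set.compl_subset_iff_union.1 h])).trans
      (measureReal_union_le S B)
  rw [probReal_univ] at h1
  linarith

end SubmatrixLocalization

theorem theorem9 :
    ∃ c₁ : ℝ, 0 < c₁ ∧
      ∀ (nL nR KL KR r : ℕ) (μ : ℝ), 0 < KL → 0 < KR → 0 < μ →
      ∀ (C : Fin r → Finset (Fin nL)) (D : Fin r → Finset (Fin nR)),
        SubmatrixLocalization.IsClusterFamily KL C →
        SubmatrixLocalization.IsClusterFamily KR D →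
      ∀ (Ω : Type*) [MeasurableSpace Ω] (P : Measure Ω) [IsProbabilityMeasure P]
        (Δ : Fin nL → Fin nR → Ω → ℝ),
        SubmatrixLocalization.IsSubGaussianNoise Δ P →
        μ ^ 2 ≥ c₁ * (Real.log ((max nL nR : ℕ) : ℝ) / ((min KL KR : ℕ) : ℝ)
          + ((max nL nR : ℕ) : ℝ) / ((KL : ℝ) * (KR : ℝ))) →
        P.real {ω | SubmatrixLocalization.IsUniqueMaximizer
            (SubmatrixLocalization.objective
              (SubmatrixLocalization.observedMatrix μ C D Δ ω))
            (SubmatrixLocalization.feasibleSet nL nR KL KR r)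
            (SubmatrixLocalization.biclusteringMatrix C D)}
          ≥ 1 - ((max nL nR : ℕ) : ℝ) ^ (-10 : ℤ) := by
  -- `8192 = 512 * 16`: with `τ = μ / 16` and `t = μ * κ / 16` below, the tail exponents are
  -- `μ ^ 2 * min KL KR / 512` and `μ ^ 2 * KL * KR / 512`, so at least `16 * log n` and `16 * n`.
  refine ⟨8192, by norm_num, ?_⟩
  intro nL nR KL KR r μ hKL hKR hμ C D hC hD Ω _ P _ Δ hΔ hsnr
  rcases Nat.lt_or_ge (max nL nR) 2 with hlt | hn
  · rcases Nat.lt_or_ge (max nL nR) 1 with h0 | h1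
    · -- for empty matrices the bound reads `1`, since `0 ^ (-10) = 0`
      have hnL : nL = 0 := by omega
      have hnR : nR = 0 := by omega
      subst hnL hnR
      have hall : {ω | SubmatrixLocalization.IsUniqueMaximizer
            (SubmatrixLocalization.objective
              (SubmatrixLocalization.observedMatrix μ C D Δ ω))
            (SubmatrixLocalization.feasibleSet 0 0 KL KR r)
            (SubmatrixLocalization.biclusteringMatrix C D)} = Set.univ :=
        Set.eq_univ_of_forall fun ω =>
          ⟨⟨hC.biclusteringMatrix_mem_feasibleSet hD hKL hKR, isMaxOn_iff.2 fun Y _ => by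
            rw [Subsingleton.elim Y (SubmatrixLocalization.biclusteringMatrix C D)]⟩,
            fun Y _ => Subsingleton.elim Y _⟩
      rw [hall, probReal_univ]
      simp
    · -- for `n = 1` the claimed lower bound is `0`
      have h1 : max nL nR = 1 := by omega
      rw [h1]
      simp
  · set n := max nL nR with hnn
    set κ := √((KL : ℝ) * KR) with hκ
    have hκ0 : 0 < κ := by positivity
    have hκκ : κ ^ 2 = KL * KR := Real.sq_sqrt (by positivity)
    have hKK : (0 : ℝ) < KL * KR := by positivity
    have hmin : (0 : ℝ) < (min KL KR : ℕ) := by exact_mod_cast lt_min hKL hKR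
    have hlog : 0 ≤ Real.log (n : ℝ) := Real.log_natCast_nonneg n
    have ha : 16 * (n : ℝ) ≤ (μ * κ / 16) ^ 2 / 2 := by
      have h1 : 8192 * ((n : ℝ) / (KL * KR)) ≤ μ ^ 2 := by
        have : 0 ≤ Real.log (n : ℝ) / (min KL KR : ℕ) := by positivity
        linarith
      rw [← mul_div_assoc, div_le_iff₀ hKK, ← hκκ] at h1
      linarith [show (μ * κ / 16) ^ 2 / 2 = μ ^ 2 * κ ^ 2 / 512 by ring]
    have hb : 16 * Real.log n ≤ (μ / 16) ^ 2 * (min KL KR : ℕ) / 2 := by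
      have h1 : 8192 * (Real.log (n : ℝ) / (min KL KR : ℕ)) ≤ μ ^ 2 := by
        have : 0 ≤ (n : ℝ) / (KL * KR) := by positivity
        linarith
      rw [← mul_div_assoc, div_le_iff₀ hmin] at h1
      linarith [show (μ / 16) ^ 2 * (min KL KR : ℕ) / 2 = μ ^ 2 * (min KL KR : ℕ) / 512 by ring]
    have hfail := hΔ.measureReal_noise_bounds_compl_le hC hD hKL hKR
      (t := μ * κ / 16) (τ := μ / 16) (by positivity) (by positivity)
    rw [neg_div, neg_div] at hfail
    have hnum := SubmatrixLocalization.failure_bound_le_zpow hn ha hb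
    refine ge_iff_le.2 (le_trans (sub_le_sub_left (hfail.trans hnum) 1)
      (SubmatrixLocalization.one_sub_le_measureReal_of_compl_subset fun ω hω hgood => hω ?_))
    obtain ⟨g₁, g₂, g₃⟩ := hgood
    rw [Set.mem_ofPred_eq, SubmatrixLocalization.observedMatrix_eq]
    refine hC.isUniqueMaximizer_of_noise_bounds hD hKL hKR (by positivity) g₁ g₂ g₃ ?_
    have : 4 * (μ * κ / 16) / κ = μ / 4 := by field_simp; norm_num
    rw [← hκ, this]
    linarith
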